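/- Let $K$ be a field and let $q\in K$ satisfy $q^k\neq 1$ for all $k\ge 1$ (for instance $K=\mathbb{R}(q)$ with $q$ an indeterminate, or $K=\mathbb{R}$ and $|q|<1$). Put $(x;q)_k=\prod_{i=0}^{k-1}(1-xq^i)$. For partitions $\mu\subseteq\lambda$ write $\mu\prec\lambda$ if $\lambda/\mu$ has at most one box in each column, and set $$\mathbb{F}_{\lambda/\mu}(x)=\mathbf 1_{\mu\prec\lambda}\;x^{|\lambda|-|\mu|}\prod_{r=1}^{\ell(\lambda)}(x;q)_{\mu_r-\lambda_{r+1}}\frac{(q;q)_{\lambda_r-\lambda_{r+1}}}{(q;q)_{\lambda_r-\mu_r}\,(q;q)_{\mu_r-\lambda_{r+1}}},$$ $$\mathbb{F}_{\lambda/\mu}(x_1,\dots,x_n)=\sum_{\mu\subseteq\kappa\prec\lambda}\mathbb{F}_{\kappa/\mu}(x_1,\dots,x_{n-1})\,\mathbb{F}_{\lambda/\kappa}(x_n),$$ where in no variables $\mathbb{F}_{\lambda/\mu}$ is $1$ if $\lambda=\mu$ and $0$ otherwise. The inhomogeneous $q$-Whittaker polynomials are $\mathbb{F}_\lambda(x_1,\dots,x_n)=\mathbb{F}_{\lambda/\varnothing}(x_1,\dots,x_n)$;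 since $\mathbb{F}_\lambda(x_1,\dots,x_n,0)=\mathbb{F}_\lambda(x_1,\dots,x_n)$, they have an inverse limit, the formal power series $\mathbb{F}_\lambda(x_1,x_2,\dots)$ in infinitely many variables. Let $\square=(1)$. Then for every partition $\nu$ $$\mathbb{F}_\square\,\mathbb{F}_\nu=\sum_{\lambda}c^\lambda_{\square,\nu}\,\mathbb{F}_\lambda ,$$ both in the variables $x_1,\dots,x_n$ for every $n\ge 0$ and in infinitely many variables $x_1,x_2,\dots$. Here the sum is over the finitely many partitions $\lambda\supsetneq\nu$ such that $\lambda/\nu$ has at most one box in each row and in each column, and $$c^\lambda_{\square,\nu}=(-1)^{|\lambda|-|\nu|-1}\,\eta_{\lambda/\nu}\,(1-q)^{|\lambda|-|\nu|},\qquad \eta_{\lambda/\nu}=\prod_{j\ge 1}\frac{(q;q)_{\nu_j-\nu_{j+1}}}{(q;q)_{\lambda_j-\nu_j}\,(q;q)_{\nu_j-\lambda_{j+1}}}.$$ -/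

import Mathlib

namespace InhomWhittaker

/-! Partitions are Young diagrams: `lam.rowLen i` is the part `lam_(i+1)` (rows are numbered
from `0`), `lam.colLen 0` is the length of `lam`, `lam.card` is its size, and `mu ≤ lam` is
containment of diagrams. -/

/-- The `q`-Pochhammer symbol `(x; q)_k`. -/
def qPoch {A : Type*} [CommRing A] (x q : A) (k : ℕ) : A :=
  ∏ i ∈ Finset.range k, (1 - x * q ^ i)

/-- `lam / mu` is a horizontal strip: `mu ⊆ lam`, and each column of `lam / mu` has at most
one box. -/
def IsHorizontalStrip (lam mu : YoungDiagram) : Prop :=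
  mu ≤ lam ∧ ∀ j, lam.colLen j - mu.colLen j ≤ 1

/-- `lam / mu` is a vertical strip: `mu ⊆ lam`, and each row of `lam / mu` has at most
one box. -/
def IsVerticalStrip (lam mu : YoungDiagram) : Prop :=
  mu ≤ lam ∧ ∀ i, lam.rowLen i - mu.rowLen i ≤ 1

theorem finite_le (lam : YoungDiagram) : {mu : YoungDiagram | mu ≤ lam}.Finite := by
  refine Set.Finite.of_finite_image (f := YoungDiagram.cells) ?_ ?_
  · refine (lam.cells.powerset.finite_toSet).subset ?_
    rintro _ ⟨mu, hmu, rfl⟩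
    simpa using YoungDiagram.cells_subset_iff.mpr hmu
  · intro a _ b _ h
    exact YoungDiagram.ext h

theorem finite_between (lam mu : YoungDiagram) :
    {kap : YoungDiagram | mu ≤ kap ∧ IsHorizontalStrip lam kap}.Finite :=
  (finite_le lam).subset fun _ h => h.2.1

/-- The finite set of all `kap` with `mu ⊆ kap` and `lam / kap` a horizontal strip. -/
noncomputable def between (lam mu : YoungDiagram) : Finset YoungDiagram :=
  (finite_between lam mu).toFinset

open Classical in
/-- The one-variable skew inhomogeneous `q`-Whittaker polynomial `F_{lam/mu}(x)`, for `x` in a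
commutative algebra over the field `K` that contains `q`. -/
noncomputable def skewOne {K : Type*} [Field K] {A : Type*} [CommRing A] [Algebra K A]
    (q : K) (lam mu : YoungDiagram) (x : A) : A :=
  if IsHorizontalStrip lam mu then
    x ^ (lam.card - mu.card) *
      ∏ r ∈ Finset.range (lam.colLen 0),
        qPoch x (algebraMap K A q) (mu.rowLen r - lam.rowLen (r + 1)) *
          algebraMap K A
            (qPoch q q (lam.rowLen r - lam.rowLen (r + 1)) /
              (qPoch q q (lam.rowLen r - mu.rowLen r) *
                qPoch q q (mu.rowLen r - lam.rowLen (r + 1))))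
  else 0

open Classical in
/-- The skew inhomogeneous `q`-Whittaker polynomial `F_{lam/mu}(x_0, …, x_(n-1))` in `n`
variables, by the branching rule; it only involves the first `n` of the variables
`x_0, x_1, …`. In no variables it is `1` if `lam = mu` and `0` otherwise. -/
noncomputable def skewF {K : Type*} [Field K] (q : K) :
    ℕ → YoungDiagram → YoungDiagram → MvPolynomial ℕ K
  | 0, lam, mu => if lam = mu then 1 else 0
  | n + 1, lam, mu =>
      ∑ kap ∈ between lam mu, skewF q n kap mu * skewOne q lam kap (MvPolynomial.X n)

/-- The inhomogeneous `q`-Whittaker polynomial `F_lam(x_0, …, x_(n-1)) = F_{lam/∅}`. -/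
noncomputable def polyF {K : Type*} [Field K] (q : K) (n : ℕ) (lam : YoungDiagram) :
    MvPolynomial ℕ K :=
  skewF q n lam ⊥

/-- The inhomogeneous `q`-Whittaker function `F_lam(x_0, x_1, …)` in infinitely many variables,
the inverse limit of the `F_lam(x_0, …, x_(n-1))`: the coefficient of a monomial `m` is the one
it has in `F_lam(x_0, …, x_(n-1))`, where `n` is the least number such that `m` only involves
`x_0, …, x_(n-1)` (by `coeff_powerF` below, every larger `n` gives the same coefficient). -/
noncomputable def powerF {K : Type*} [Field K] (q : K) (lam : YoungDiagram) :
    MvPowerSeries ℕ K :=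
  fun m => (polyF q (m.support.sup Nat.succ) lam).coeff m

/-- The diagram with a single box. -/
def box : YoungDiagram where
  cells := {(0, 0)}
  isLowerSet := by
    intro a b hba ha
    have ha' : a = (0, 0) := by simpa using ha
    subst ha'
    have : b = (0, 0) := le_antisymm hba (by simp [Prod.le_def])
    simp [this]

theorem finite_pieri (nu : YoungDiagram) :
    {lam : YoungDiagram | lam ≠ nu ∧ IsHorizontalStrip lam nu ∧ IsVerticalStrip lam nu}.Finite := by
  refine Set.Finite.of_finite_image (f := YoungDiagram.cells) ?_ ?_
  · refine ((Finset.range (nu.colLen 0 + 1) ×ˢ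
      Finset.range (nu.rowLen 0 + 1)).powerset.finite_toSet).subset ?_
    rintro _ ⟨lam, ⟨-, ⟨-, hc⟩, -, hr⟩, rfl⟩
    rw [Finset.mem_coe, Finset.mem_powerset]
    rintro ⟨i, j⟩ hij
    have h1 := YoungDiagram.mem_iff_lt_colLen.mp (lam.up_left_mem le_rfl (Nat.zero_le j) hij)
    have h2 := YoungDiagram.mem_iff_lt_rowLen.mp (lam.up_left_mem (Nat.zero_le i) le_rfl hij)
    have h3 := hc 0
    have h4 := hr 0
    simp only [Finset.mem_product, Finset.mem_range]
    omega
  · intro a _ b _ h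
    exact YoungDiagram.ext h

/-- The finite set of all `lam ≠ nu` that contain `nu` and for which `lam / nu` has at most one
box in each row and in each column. -/
noncomputable def pieriSet (nu : YoungDiagram) : Finset YoungDiagram :=
  (finite_pieri nu).toFinset

/-- The product `η_{lam/nu}` of ratios of `q`-Pochhammer symbols, for `nu ⊆ lam` (the factors of
rows below the last row of `lam` are `1`). -/
noncomputable def eta {K : Type*} [Field K] (q : K) (lam nu : YoungDiagram) : K :=
  ∏ j ∈ Finset.range (lam.colLen 0),
    qPoch q q (nu.rowLen j - nu.rowLen (j + 1)) /
      (qPoch q q (lam.rowLen j - nu.rowLen j) * qPoch q q (nu.rowLen j - lam.rowLen (j + 1)))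

/-- The coefficient of `F_lam` in the product of `F_nu` with the function of a single box. -/
noncomputable def pieriCoeff {K : Type*} [Field K] (q : K) (lam nu : YoungDiagram) : K :=
  (-1) ^ (lam.card - nu.card - 1) * eta q lam nu * (1 - q) ^ (lam.card - nu.card)

/-! Basic facts showing that the definitions are coherent. -/

theorem mem_between {lam mu kap : YoungDiagram} :
    kap ∈ between lam mu ↔ mu ≤ kap ∧ IsHorizontalStrip lam kap := by
  simp [between]

theorem mem_pieriSet {lam nu : YoungDiagram} :
    lam ∈ pieriSet nu ↔ lam ≠ nu ∧ IsHorizontalStrip lam nu ∧ IsVerticalStrip lam nu := by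
  simp [pieriSet]

theorem skewF_one {K : Type*} [Field K] (q : K) (lam mu : YoungDiagram) :
    skewF q 1 lam mu = skewOne q lam mu (MvPolynomial.X 0) := by
  classical
  simp only [skewF, ite_mul, one_mul, zero_mul, Finset.sum_ite_eq', mem_between, le_refl, true_and]
  split_ifs with h
  · rfl
  · simp [skewOne, h]

theorem qPoch_ne_zero {K : Type*} [Field K] (q : K) (hq : ∀ k : ℕ, 0 < k → q ^ k ≠ 1) (k : ℕ) :
    qPoch q q k ≠ 0 := by
  refine Finset.prod_ne_zero_iff.mpr fun i _ h => hq (i + 1) (Nat.succ_pos i) ?_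
  rw [pow_succ']
  exact (sub_eq_zero.mp h).symm

theorem card_lt_of_lt {lam mu : YoungDiagram} (h : mu ≤ lam) (hne : mu ≠ lam) :
    mu.card < lam.card :=
  Finset.card_lt_card (YoungDiagram.cells_ssubset_iff.mpr (lt_of_le_of_ne h hne))

/-- Setting the variable to `0` in the one-variable polynomial. -/
theorem skewOne_zero {K : Type*} [Field K] {A : Type*} [CommRing A] [Algebra K A]
    (q : K) (hq : ∀ k : ℕ, 0 < k → q ^ k ≠ 1) (lam mu : YoungDiagram) [Decidable (lam = mu)] :
    skewOne q lam mu (0 : A) = if lam = mu then 1 else 0 := by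
  classical
  by_cases h : lam = mu
  · subst h
    have hs : IsHorizontalStrip lam lam := ⟨le_rfl, fun j => by simp⟩
    have h0 : ∀ k, qPoch q q k ≠ 0 := qPoch_ne_zero q hq
    rw [skewOne, if_pos hs, if_pos rfl, Nat.sub_self, pow_zero, one_mul]
    refine Finset.prod_eq_one fun r _ => ?_
    have h1 : ∀ k, qPoch (0 : A) (algebraMap K A q) k = 1 := fun k => by simp [qPoch]
    have h2 : qPoch q q 0 = 1 := by simp [qPoch]
    rw [h1, Nat.sub_self, h2, one_mul, one_mul, div_self (h0 _), map_one]
  · rw [if_neg h, skewOne]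
    split_ifs with hs
    · have := card_lt_of_lt hs.1 (Ne.symm h)
      rw [zero_pow (by omega), zero_mul]
    · rfl

/-- Evaluating a one-variable polynomial commutes with algebra homomorphisms. -/
theorem map_skewOne {K : Type*} [Field K] {A B : Type*} [CommRing A] [Algebra K A]
    [CommRing B] [Algebra K B] (f : A →ₐ[K] B) (q : K) (lam mu : YoungDiagram) (x : A) :
    f (skewOne q lam mu x) = skewOne q lam mu (f x) := by
  unfold skewOne
  split_ifs with hs
  · simp [qPoch, map_prod]
  · simp

/-- Keep the variables `x_i` with `i < n`, and set all the others to `0`. -/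
noncomputable def truncVars (K : Type*) [Field K] (n : ℕ) :
    MvPolynomial ℕ K →ₐ[K] MvPolynomial ℕ K :=
  MvPolynomial.aeval fun i => if i < n then MvPolynomial.X i else 0

theorem truncVars_skewF_of_le {K : Type*} [Field K] (q : K) (n N : ℕ) (hn : N ≤ n)
    (lam mu : YoungDiagram) : truncVars K n (skewF q N lam mu) = skewF q N lam mu := by
  classical
  induction N generalizing lam with
  | zero => simp only [skewF]; split_ifs <;> simp
  | succ N ih =>
    simp only [skewF, map_sum, map_mul, map_skewOne]
    refine Finset.sum_congr rfl fun kap _ => ?_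
    rw [ih (by omega)]
    congr 2
    simp [truncVars, show N < n by omega]

/-- Stability: setting further variables to `0`. -/
theorem truncVars_skewF {K : Type*} [Field K] (q : K) (hq : ∀ k : ℕ, 0 < k → q ^ k ≠ 1)
    (n N : ℕ) (hn : n ≤ N) (lam mu : YoungDiagram) :
    truncVars K n (skewF q N lam mu) = skewF q n lam mu := by
  classical
  induction N, hn using Nat.le_induction generalizing lam with
  | base => exact truncVars_skewF_of_le q n n le_rfl lam mu
  | succ N hN ih =>
    simp only [skewF, map_sum, map_mul, map_skewOne, ih]
    have h0 : truncVars K n (MvPolynomial.X N) = 0 := by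
      simp [truncVars, show ¬ N < n by omega]
    simp only [h0, skewOne_zero q hq, mul_ite, mul_one, mul_zero]
    rw [Finset.sum_ite_eq]
    split_ifs with h
    · rfl
    · rw [mem_between] at h
      have hle : ¬ mu ≤ lam := fun hh => h ⟨hh, le_rfl, fun j => by simp⟩
      clear ih h h0 hN
      cases n with
      | zero =>
        simp only [skewF]
        rw [if_neg]
        rintro rfl
        exact hle le_rfl
      | succ n =>
        simp only [skewF]
        refine (Finset.sum_eq_zero fun kap hk => ?_).symm
        rw [mem_between] at hk
        exact absurd (hk.1.trans hk.2.1) hle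

theorem coeff_truncVars {K : Type*} [Field K] (n : ℕ) (m : ℕ →₀ ℕ)
    (hm : ∀ i ∈ m.support, i < n) (p : MvPolynomial ℕ K) :
    (truncVars K n p).coeff m = p.coeff m := by
  classical
  induction p using MvPolynomial.induction_on' with
  | add p r hp hr => simp [hp, hr]
  | monomial u a =>
    rw [truncVars, MvPolynomial.aeval_monomial]
    by_cases hu : ∀ i ∈ u.support, i < n
    · have : (u.prod fun i k => (if i < n then MvPolynomial.X i else 0 : MvPolynomial ℕ K) ^ k)
          = u.prod fun i k => MvPolynomial.X i ^ k :=
        Finsupp.prod_congr fun i hi => by rw [if_pos (hu i hi)]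
      rw [this, MvPolynomial.algebraMap_eq, ← MvPolynomial.monomial_eq]
    · push Not at hu
      obtain ⟨i, hi, hin⟩ := hu
      have : (u.prod fun i k =>
          (if i < n then MvPolynomial.X i else 0 : MvPolynomial ℕ K) ^ k) = 0 := by
        refine Finset.prod_eq_zero hi ?_
        simp [show ¬ i < n by omega, Finsupp.mem_support_iff.mp hi]
      rw [this, mul_zero, MvPolynomial.coeff_zero, MvPolynomial.coeff_monomial, if_neg]
      rintro rfl
      exact absurd (hm i hi) (by omega)

/-- The coefficients of `powerF` are the stable coefficients of the polynomials. -/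
theorem coeff_powerF {K : Type*} [Field K] (q : K) (hq : ∀ k : ℕ, 0 < k → q ^ k ≠ 1)
    (lam : YoungDiagram) (m : ℕ →₀ ℕ) (N : ℕ) (hN : ∀ i ∈ m.support, i < N) :
    MvPowerSeries.coeff m (powerF q lam) = (polyF q N lam).coeff m := by
  have hle : m.support.sup Nat.succ ≤ N := Finset.sup_le fun i hi => hN i hi
  change (polyF q (m.support.sup Nat.succ) lam).coeff m = _
  rw [polyF, ← truncVars_skewF q hq _ N hle, coeff_truncVars]
  · rfl
  · intro i hi
    exact Finset.le_sup (f := Nat.succ) hi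

end InhomWhittaker

/-! The box function is $\mathbb F_\square = 1-\prod_i(1-x_i)$, so the Pieri rule amounts to
expanding $\prod_i(1-x_i)\,\mathbb F_\nu$, and this product splits over the variables. Let
$W(\lambda,\nu)=(-1)^{|\lambda/\nu|}\eta_{\lambda/\nu}(1-q)^{|\lambda/\nu|}$ when $\lambda/\nu$ is
both a horizontal and a vertical strip, with $\lambda=\nu$ allowed, and $0$ otherwise
(`pieriWeight`). By induction on $n$ through the branching rule, $\prod_i(1-x_i)\,\mathbb
F_\nu=\sum_\lambda W(\lambda,\nu)\mathbb F_\lambda$ follows from the one-variable commutation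
relation (`pieriWeight_skewOne_comm`) $$(1-x)\sum_\kappa \mathbb
F_{\nu/\kappa}(x)W(\rho,\kappa)=\sum_\lambda W(\lambda,\nu)\mathbb F_{\lambda/\rho}(x).$$ The
formula for $\mathbb F_\square$ is itself the case $\nu=\varnothing$.

For fixed $\nu,\rho$, encode $\kappa$ by the set $T$ of rows where $\rho$ loses a box, and $\lambda$
by the set $T$ of rows where $\nu$ gains one. After extracting $\prod_j(q;q)_{\nu_j-\nu_{j+1}}$,
each side is a sum over all $T\subseteq\{0,\dots,N-1\}$ of products of row factors in
$s_j=\nu_j-\rho_j$ and $p_j=\rho_j-\nu_{j+1}$; sets $T$ that give no admissible diagram have weight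
$0$.

The factor of row $j$ sees, besides $j$ itself, only one neighbour: row $j+1$ when boxes are added,
row $j-1$ when they are removed. Both sums are thus computed by two-state transfer matrices, and a
linear map intertwines these (`transfer_invariant`). Below both diagrams $p=0$, and there the map
reduces to the factor $1-x$. -/

namespace InhomWhittaker

/-! ### Row weights and their recurrences -/

section RowWeights

variable {K : Type*} [Field K] {A : Type*} [CommRing A] [Algebra K A]

/-- `x ^ s / (q; q)_s`, extended by zero to negative `s`. -/
noncomputable def powWeight (q : K) (x : A) (s : ℤ) : A :=
  if 0 ≤ s then x ^ s.toNat * algebraMap K A (qPoch q q s.toNat)⁻¹ else 0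

/-- `(x; q)_p / (q; q)_p`, extended by zero to negative `p`. -/
noncomputable def pochWeight (q : K) (x : A) (p : ℤ) : A :=
  if 0 ≤ p then qPoch x (algebraMap K A q) p.toNat * algebraMap K A (qPoch q q p.toNat)⁻¹ else 0

/-- The power `q ^ k`, with the exponent truncated at zero. -/
noncomputable def qPow (A : Type*) [CommRing A] [Algebra K A] (q : K) (k : ℤ) : A :=
  algebraMap K A q ^ k.toNat

theorem qPoch_succ {B : Type*} [CommRing B] (x q : B) (k : ℕ) :
    qPoch x q (k + 1) = qPoch x q k * (1 - x * q ^ k) := by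
  simp [qPoch, Finset.prod_range_succ]

theorem powWeight_of_neg (q : K) (x : A) {s : ℤ} (hs : s < 0) : powWeight q x s = 0 :=
  if_neg (by omega)

theorem pochWeight_of_neg (q : K) (x : A) {p : ℤ} (hp : p < 0) : pochWeight q x p = 0 :=
  if_neg (by omega)

theorem powWeight_natCast (q : K) (x : A) (s : ℕ) :
    powWeight q x s = x ^ s * algebraMap K A (qPoch q q s)⁻¹ := by
  simp [powWeight]

theorem pochWeight_natCast (q : K) (x : A) (p : ℕ) :
    pochWeight q x p = qPoch x (algebraMap K A q) p * algebraMap K A (qPoch q q p)⁻¹ := by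
  simp [pochWeight]

theorem qPow_natCast (q : K) (k : ℕ) : qPow A q k = algebraMap K A q ^ k := by
  simp [qPow]

theorem qPow_add (q : K) {k l : ℤ} (hk : 0 ≤ k) (hl : 0 ≤ l) :
    qPow A q (k + l) = qPow A q k * qPow A q l := by
  lift k to ℕ using hk
  lift l to ℕ using hl
  rw [← Nat.cast_add, qPow_natCast, qPow_natCast, qPow_natCast, pow_add]

/-- Cancellation of the last factor of $(q;q)_{s+1}$. It survives at $s=-1$, where the left weight
and $1-q^0$ both vanish, so the extension by zero is consistent with the recurrence. -/
theorem x_mul_powWeight (q : K) (hq : ∀ k : ℕ, 0 < k → q ^ k ≠ 1) (x : A) (s : ℤ) :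
    x * powWeight q x s = powWeight q x (s + 1) * (1 - qPow A q (s + 1)) := by
  rcases lt_or_ge s 0 with hs | hs
  · rw [powWeight_of_neg q x hs]
    rcases eq_or_ne s (-1) with rfl | h
    · simp [qPow]
    · rw [powWeight_of_neg q x (by omega)]
      simp
  · lift s to ℕ using hs
    have h1 := qPoch_ne_zero q hq (s + 1)
    have h0 := qPoch_ne_zero q hq s
    have key : (qPoch q q s)⁻¹ = (qPoch q q (s + 1))⁻¹ * (1 - q ^ (s + 1)) := by
      rw [qPoch_succ, ← pow_succ'] at h1 ⊢
      field_simp [right_ne_zero_of_mul h1]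
    have : ((s : ℤ) + 1) = ((s + 1 : ℕ) : ℤ) := by push_cast; rfl
    rw [this, powWeight_natCast, powWeight_natCast, qPow_natCast, key]
    simp only [map_mul, map_sub, map_one, map_pow]
    ring

theorem pochWeight_mul (q : K) (hq : ∀ k : ℕ, 0 < k → q ^ k ≠ 1) (x : A) {p : ℤ} (hp : 0 < p) :
    pochWeight q x p * (1 - qPow A q p) =
      pochWeight q x (p - 1) * (1 - x * qPow A q (p - 1)) := by
  obtain ⟨k, rfl⟩ : ∃ k : ℕ, p = ((k + 1 : ℕ) : ℤ) := ⟨(p - 1).toNat, by omega⟩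
  have h1 := qPoch_ne_zero q hq (k + 1)
  have h0 := qPoch_ne_zero q hq k
  have key : (qPoch q q k)⁻¹ = (qPoch q q (k + 1))⁻¹ * (1 - q ^ (k + 1)) := by
    rw [qPoch_succ, ← pow_succ'] at h1 ⊢
    field_simp [right_ne_zero_of_mul h1]
  have : (((k + 1 : ℕ) : ℤ) - 1) = (k : ℤ) := by push_cast; ring
  rw [this, pochWeight_natCast, pochWeight_natCast, qPow_natCast, qPow_natCast, key,
    qPoch_succ x]
  simp only [map_mul, map_sub, map_one, map_pow]
  ring

/-! ### Intertwining of the two transfer matrices -/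

/-- One step of the intertwining of the two transfer matrices, for a state `0`. -/
theorem transfer_step_zero (q : K) (hq : ∀ k : ℕ, 0 < k → q ^ k ≠ 1) (x P C : A) (s p : ℤ) :
    ((P - x * C) * powWeight q x s -
        (P - C) * (powWeight q x (s + 1) * (1 - qPow A q (p + s + 1)))) * pochWeight q x p =
      P * powWeight q x s * pochWeight q x p * (1 - x * qPow A q p) -
        (P - C * qPow A q (s + 1)) * powWeight q x (s + 1) * pochWeight q x (p - 1) *
          (1 - x * qPow A q (p - 1)) := by
  rcases lt_or_ge s (-1) with hs | hs
  · simp [powWeight_of_neg q x (show s < 0 by omega), powWeight_of_neg q x (show s + 1 < 0 by omega)]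
  rcases lt_or_ge p 0 with hp | hp
  · simp [pochWeight_of_neg q x hp, pochWeight_of_neg q x (show p - 1 < 0 by omega)]
  have h1 := x_mul_powWeight q hq x s
  rw [add_assoc, qPow_add q hp (show 0 ≤ s + 1 by omega)]
  -- The recurrence in $p$ needs $p>0$. At $p=0$ the weight at $p-1$ is zero, and the recurrence in
  -- $s$ alone suffices.
  rcases eq_or_lt_of_le hp with rfl | hp
  · rw [pochWeight_of_neg q x (show (0 : ℤ) - 1 < 0 by omega)]
    have h0 : qPow A q 0 = 1 := by simp [qPow]
    rw [h0]
    linear_combination (P - C) * pochWeight q x 0 * h1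
  · have h2 := pochWeight_mul q hq x hp
    linear_combination (P * qPow A q p - C) * pochWeight q x p * h1 -
      (P - C * qPow A q (s + 1)) * powWeight q x (s + 1) * h2

/-- One step of the intertwining of the two transfer matrices, for a state `1`. -/
theorem transfer_step_one (q : K) (hq : ∀ k : ℕ, 0 < k → q ^ k ≠ 1) (x P C : A) (s p : ℤ) :
    ((P - x * C) * powWeight q x s -
        (P - C) * (powWeight q x (s + 1) * (1 - qPow A q (p + s)))) * pochWeight q x (p - 1) =
      P * powWeight q x s * pochWeight q x p * (1 - qPow A q p) -
        (P - C * qPow A q (s + 1)) * powWeight q x (s + 1) * pochWeight q x (p - 1) *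
          (1 - qPow A q (p - 1)) := by
  rcases lt_or_ge s (-1) with hs | hs
  · simp [powWeight_of_neg q x (show s < 0 by omega), powWeight_of_neg q x (show s + 1 < 0 by omega)]
  rcases lt_trichotomy p 0 with hp | rfl | hp
  · simp [pochWeight_of_neg q x hp, pochWeight_of_neg q x (show p - 1 < 0 by omega)]
  · have h0 : qPow A q 0 = 1 := by simp [qPow]
    rw [pochWeight_of_neg q x (show (0 : ℤ) - 1 < 0 by omega), h0]
    ring
  · have h1 := x_mul_powWeight q hq x s
    have h2 := pochWeight_mul q hq x hp
    rw [show p + s = (p - 1) + (s + 1) by ring,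
      qPow_add q (show 0 ≤ p - 1 by omega) (show 0 ≤ s + 1 by omega)]
    linear_combination (P * qPow A q (p - 1) - C) * pochWeight q x (p - 1) * h1 -
      P * powWeight q x s * h2

/-- The indicator of membership of `j` in `T`. -/
def bit (T : Finset ℕ) (j : ℕ) : ℕ := if j ∈ T then 1 else 0

/-- The power of `q` by which row `N` interacts with the row above it when boxes are removed from
the rows in `T`. -/
noncomputable def link (A : Type*) [CommRing A] [Algebra K A] (q : K) (p : ℕ → ℤ)
    (T : Finset ℕ) : ℕ → A
  | 0 => 0
  | N + 1 => qPow A q (p N - bit T N)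

/-- The factor of row `j` when boxes are removed from the rows in `T`. -/
noncomputable def removeFactor (q : K) (x : A) (s p : ℕ → ℤ) (T : Finset ℕ) (j : ℕ) : A :=
  if j ∈ T then
    -((1 - link A q p T j * qPow A q (s j + 1)) * powWeight q x (s j + 1) *
      pochWeight q x (p j - 1))
  else powWeight q x (s j) * pochWeight q x (p j)

/-- The factor of row `j` when boxes are added to the rows in `T`. -/
noncomputable def addFactor (q : K) (x : A) (s p : ℕ → ℤ) (T : Finset ℕ) (j : ℕ) : A :=
  (if j ∈ T then
    -(powWeight q x (s j + 1) * (1 - qPow A q (p j + s j + 1 - bit T (j + 1))))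
  else powWeight q x (s j)) * pochWeight q x (p j - bit T (j + 1))

theorem prod_removeFactor_insert (q : K) (x : A) (s p : ℕ → ℤ) (T : Finset ℕ) {n N : ℕ}
    (h : N ≤ n) :
    ∏ j ∈ Finset.range N, removeFactor q x s p (insert n T) j =
      ∏ j ∈ Finset.range N, removeFactor q x s p T j := by
  refine Finset.prod_congr rfl fun j hj => ?_
  have hj := Finset.mem_range.mp hj
  have h1 : j ∈ insert n T ↔ j ∈ T := by simp [show j ≠ n by omega]
  have h2 : link A q p (insert n T) j = link A q p T j := by
    cases j with
    | zero => rfl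
    | succ j => simp [link, bit, show j ≠ n by omega]
  simp only [removeFactor, h1, h2]

theorem prod_addFactor_insert (q : K) (x : A) (s p : ℕ → ℤ) (T : Finset ℕ) {n N : ℕ}
    (h : N < n) :
    ∏ j ∈ Finset.range N, addFactor q x s p (insert n T) j =
      ∏ j ∈ Finset.range N, addFactor q x s p T j := by
  refine Finset.prod_congr rfl fun j hj => ?_
  have hj := Finset.mem_range.mp hj
  simp [addFactor, bit, show j ≠ n by omega, show j + 1 ≠ n by omega]

theorem link_insert (q : K) (p : ℕ → ℤ) (T : Finset ℕ) (N : ℕ) :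
    link A q p (insert N T) N = link A q p T N := by
  cases N with
  | zero => rfl
  | succ N => simp [link, bit]

/-- The two conjuncts are the two boundary states of the adding sum cut after $N$ rows: row $N$
receives no box, or receives one. Let $P$ be the removing sum over the same rows and $C$ the same
sum weighted by the link to row $N$. The adding sums are then $P-xC$ and $P-C$. Initially $P=1$ and
$C=0$, as nothing lies above the top row; `transfer_step_zero` and `transfer_step_one` propagate the
two relations. -/
theorem transfer_invariant (q : K) (hq : ∀ k : ℕ, 0 < k → q ^ k ≠ 1) (x : A) (s p : ℕ → ℤ)
    (N : ℕ) :
    (∑ T ∈ (Finset.range N).powerset, ∏ j ∈ Finset.range N, addFactor q x s p T j =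
      ∑ T ∈ (Finset.range N).powerset, (∏ j ∈ Finset.range N, removeFactor q x s p T j) -
        x * ∑ T ∈ (Finset.range N).powerset,
          (∏ j ∈ Finset.range N, removeFactor q x s p T j) * link A q p T N) ∧
    (∑ T ∈ (Finset.range N).powerset, ∏ j ∈ Finset.range N, addFactor q x s p (insert N T) j =
      ∑ T ∈ (Finset.range N).powerset, (∏ j ∈ Finset.range N, removeFactor q x s p T j) -
        ∑ T ∈ (Finset.range N).powerset,
          (∏ j ∈ Finset.range N, removeFactor q x s p T j) * link A q p T N) := by
  induction N with
  | zero => simp [link]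
  | succ N ih =>
    obtain ⟨ih0, ih1⟩ := ih
    set P := ∑ T ∈ (Finset.range N).powerset, ∏ j ∈ Finset.range N, removeFactor q x s p T j
      with hP
    set C := ∑ T ∈ (Finset.range N).powerset,
      (∏ j ∈ Finset.range N, removeFactor q x s p T j) * link A q p T N with hC
    have hmem : ∀ T ∈ (Finset.range N).powerset, N ∉ T ∧ N + 1 ∉ T := fun T hT => by
      have hT := Finset.mem_powerset.mp hT
      exact ⟨fun h => by simpa using hT h, fun h => by have := Finset.mem_range.mp (hT h); omega⟩
    have split : ∀ f : Finset ℕ → A, ∑ T ∈ (Finset.range (N + 1)).powerset, f T =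
        ∑ T ∈ (Finset.range N).powerset, f T + ∑ T ∈ (Finset.range N).powerset, f (insert N T) :=
      fun f => by
        rw [Finset.range_add_one, Finset.sum_powerset_insert Finset.notMem_range_self]
    have r0 : ∀ T ∈ (Finset.range N).powerset,
        ∏ j ∈ Finset.range (N + 1), removeFactor q x s p T j =
          (∏ j ∈ Finset.range N, removeFactor q x s p T j) *
            (powWeight q x (s N) * pochWeight q x (p N)) := fun T hT => by
      rw [Finset.prod_range_succ, removeFactor, if_neg (hmem T hT).1]
    have r1 : ∀ T ∈ (Finset.range N).powerset,
        ∏ j ∈ Finset.range (N + 1), removeFactor q x s p (insert N T) j =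
          ((∏ j ∈ Finset.range N, removeFactor q x s p T j) -
            (∏ j ∈ Finset.range N, removeFactor q x s p T j) * link A q p T N *
              qPow A q (s N + 1)) *
            -(powWeight q x (s N + 1) * pochWeight q x (p N - 1)) := fun T hT => by
      rw [Finset.prod_range_succ, prod_removeFactor_insert q x s p T le_rfl, removeFactor,
        if_pos (Finset.mem_insert_self N T), link_insert]
      ring
    have l0 : ∀ T ∈ (Finset.range N).powerset, link A q p T (N + 1) = qPow A q (p N) :=
      fun T hT => by simp [link, bit, (hmem T hT).1]
    have l1 : ∀ T ∈ (Finset.range N).powerset,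
        link A q p (insert N T) (N + 1) = qPow A q (p N - 1) :=
      fun T hT => by simp [link, bit]
    have hP' : ∑ T ∈ (Finset.range (N + 1)).powerset,
        ∏ j ∈ Finset.range (N + 1), removeFactor q x s p T j =
          P * powWeight q x (s N) * pochWeight q x (p N) -
            (P - C * qPow A q (s N + 1)) * powWeight q x (s N + 1) * pochWeight q x (p N - 1) := by
      rw [split, Finset.sum_congr rfl r0, Finset.sum_congr rfl r1, ← Finset.sum_mul,
        ← Finset.sum_mul, Finset.sum_sub_distrib, ← Finset.sum_mul, ← hP, ← hC]
      ring
    have hC' : ∑ T ∈ (Finset.range (N + 1)).powerset,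
        (∏ j ∈ Finset.range (N + 1), removeFactor q x s p T j) * link A q p T (N + 1) =
          P * powWeight q x (s N) * pochWeight q x (p N) * qPow A q (p N) -
            (P - C * qPow A q (s N + 1)) * powWeight q x (s N + 1) * pochWeight q x (p N - 1) *
              qPow A q (p N - 1) := by
      rw [split, Finset.sum_congr rfl fun T hT => congrArg₂ (· * ·) (r0 T hT) (l0 T hT),
        Finset.sum_congr rfl fun T hT => congrArg₂ (· * ·) (r1 T hT) (l1 T hT), ← Finset.sum_mul,
        ← Finset.sum_mul, ← Finset.sum_mul,
        ← Finset.sum_mul, Finset.sum_sub_distrib, ← Finset.sum_mul, ← hP, ← hC]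
      ring
    have a00 : ∀ T ∈ (Finset.range N).powerset,
        ∏ j ∈ Finset.range (N + 1), addFactor q x s p T j =
          (∏ j ∈ Finset.range N, addFactor q x s p T j) *
            (powWeight q x (s N) * pochWeight q x (p N)) := fun T hT => by
      simp [Finset.prod_range_succ, addFactor, bit, hmem T hT]
    have a10 : ∀ T ∈ (Finset.range N).powerset,
        ∏ j ∈ Finset.range (N + 1), addFactor q x s p (insert N T) j =
          (∏ j ∈ Finset.range N, addFactor q x s p (insert N T) j) *
            (-(powWeight q x (s N + 1) * (1 - qPow A q (p N + s N + 1))) *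
              pochWeight q x (p N)) := fun T hT => by
      rw [Finset.prod_range_succ, addFactor.eq_1 q x s p _ N]
      simp [bit, hmem T hT]
    have a01 : ∀ T ∈ (Finset.range N).powerset,
        ∏ j ∈ Finset.range (N + 1), addFactor q x s p (insert (N + 1) T) j =
          (∏ j ∈ Finset.range N, addFactor q x s p T j) *
            (powWeight q x (s N) * pochWeight q x (p N - 1)) := fun T hT => by
      rw [Finset.prod_range_succ, prod_addFactor_insert q x s p T (Nat.lt_succ_self N),
        addFactor.eq_1 q x s p _ N]
      simp [bit, hmem T hT]
    have a11 : ∀ T ∈ (Finset.range N).powerset,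
        ∏ j ∈ Finset.range (N + 1), addFactor q x s p (insert (N + 1) (insert N T)) j =
          (∏ j ∈ Finset.range N, addFactor q x s p (insert N T) j) *
            (-(powWeight q x (s N + 1) * (1 - qPow A q (p N + s N))) *
              pochWeight q x (p N - 1)) := fun T hT => by
      rw [Finset.prod_range_succ, prod_addFactor_insert q x s p _ (Nat.lt_succ_self N),
        addFactor.eq_1 q x s p _ N]
      simp [bit]
    rw [hP', hC']
    constructor
    · rw [split, Finset.sum_congr rfl a00, Finset.sum_congr rfl a10, ← Finset.sum_mul,
        ← Finset.sum_mul, ih0, ih1]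
      linear_combination transfer_step_zero q hq x P C (s N) (p N)
    · rw [split, Finset.sum_congr rfl a01, Finset.sum_congr rfl a11, ← Finset.sum_mul,
        ← Finset.sum_mul, ih0, ih1]
      linear_combination transfer_step_one q hq x P C (s N) (p N)

/-- The sums over added and over removed boxes agree up to the factor `1 - x`. -/
theorem sum_prod_addFactor (q : K) (hq : ∀ k : ℕ, 0 < k → q ^ k ≠ 1) (x : A) (s p : ℕ → ℤ)
    (N : ℕ) (hp : p N = 0) :
    ∑ T ∈ (Finset.range (N + 1)).powerset, ∏ j ∈ Finset.range (N + 1), addFactor q x s p T j =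
      (1 - x) * ∑ T ∈ (Finset.range (N + 1)).powerset,
        ∏ j ∈ Finset.range (N + 1), removeFactor q x s p T j := by
  rw [(transfer_invariant q hq x s p (N + 1)).1, sub_mul, one_mul]
  congr 2
  refine Finset.sum_congr rfl fun T _ => ?_
  -- Since $p_N=0$, the exponent is $0$ or $-1$; truncation makes the link $1$ for every $T$, so the
  -- weighted and unweighted sums coincide.
  simp [link, qPow, hp]

end RowWeights

/-! ### Young diagrams through their row lengths -/

theorem rowLen_eq_zero_of_colLen_le (mu : YoungDiagram) {i : ℕ} (h : mu.colLen 0 ≤ i) :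
    mu.rowLen i = 0 := by
  by_contra hne
  have h1 := YoungDiagram.mem_iff_lt_rowLen.mpr (Nat.pos_of_ne_zero hne)
  have h2 := YoungDiagram.mem_iff_lt_colLen.mp h1
  omega

theorem colLen_zero_le_of_rowLen_eq_zero (mu : YoungDiagram) {i : ℕ} (h : mu.rowLen i = 0) :
    mu.colLen 0 ≤ i := by
  by_contra hlt
  have h1 := YoungDiagram.mem_iff_lt_colLen.mpr (not_le.mp hlt)
  have h2 := YoungDiagram.mem_iff_lt_rowLen.mp h1
  omega

theorem le_iff_rowLen_le {mu lam : YoungDiagram} :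
    mu ≤ lam ↔ ∀ i, mu.rowLen i ≤ lam.rowLen i := by
  constructor
  · intro h i
    by_contra hlt
    have h1 := h (YoungDiagram.mem_iff_lt_rowLen.mpr (not_le.mp hlt))
    exact absurd (YoungDiagram.mem_iff_lt_rowLen.mp h1) (lt_irrefl _)
  · rintro h ⟨i, j⟩ hij
    exact YoungDiagram.mem_iff_lt_rowLen.mpr
      ((YoungDiagram.mem_iff_lt_rowLen.mp hij).trans_le (h i))

theorem eq_of_rowLen_eq {mu lam : YoungDiagram} (h : ∀ i, mu.rowLen i = lam.rowLen i) :
    mu = lam :=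
  le_antisymm (le_iff_rowLen_le.mpr fun i => (h i).le) (le_iff_rowLen_le.mpr fun i => (h i).ge)

/-- Horizontal strips are the pairs of interlacing partitions. -/
theorem isHorizontalStrip_iff {lam mu : YoungDiagram} :
    IsHorizontalStrip lam mu ↔
      ∀ i, mu.rowLen i ≤ lam.rowLen i ∧ lam.rowLen (i + 1) ≤ mu.rowLen i := by
  constructor
  · rintro ⟨hle, h⟩ i
    refine ⟨le_iff_rowLen_le.mp hle i, ?_⟩
    by_contra hlt
    have h1 := YoungDiagram.mem_iff_lt_colLen.mp
      (YoungDiagram.mem_iff_lt_rowLen.mpr (not_le.mp hlt))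
    have h2 : ¬ i < mu.colLen (mu.rowLen i) := fun hi =>
      lt_irrefl _ (YoungDiagram.mem_iff_lt_rowLen.mp (YoungDiagram.mem_iff_lt_colLen.mpr hi))
    have h3 := h (mu.rowLen i)
    omega
  · intro h
    refine ⟨le_iff_rowLen_le.mpr fun i => (h i).1, fun j => ?_⟩
    by_contra hlt
    have h1 := YoungDiagram.mem_iff_lt_rowLen.mp
      (YoungDiagram.mem_iff_lt_colLen.mpr (show mu.colLen j + 1 < lam.colLen j by omega))
    exact lt_irrefl _ (YoungDiagram.mem_iff_lt_colLen.mp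
      (YoungDiagram.mem_iff_lt_rowLen.mpr (h1.trans_le (h (mu.colLen j)).2)))

theorem card_eq_sum_rowLen (mu : YoungDiagram) {N : ℕ} (hN : mu.colLen 0 ≤ N) :
    mu.card = ∑ i ∈ Finset.range N, mu.rowLen i := by
  have hmaps : Set.MapsTo Prod.fst (mu.cells : Set (ℕ × ℕ)) (Finset.range N) := by
    rintro ⟨i, j⟩ hij
    have hij' : (i, j) ∈ mu := hij
    have := YoungDiagram.mem_iff_lt_colLen.mp (mu.up_left_mem le_rfl (Nat.zero_le j) hij')
    simp only [Finset.coe_range, Set.mem_Iio]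
    omega
  rw [YoungDiagram.card, Finset.card_eq_sum_card_fiberwise hmaps]
  exact Finset.sum_congr rfl fun i _ => (mu.rowLen_eq_card).symm

theorem exists_rowLen_eq (f : ℕ → ℕ) (hf : ∀ i, f (i + 1) ≤ f i) (N : ℕ) (hN : f N = 0) :
    ∃ mu : YoungDiagram, ∀ i, mu.rowLen i = f i := by
  have hanti : Antitone f := antitone_nat_of_succ_le hf
  have hmem : ∀ i j, (i, j) ∈ (Finset.range N ×ˢ Finset.range (f 0)).filter
      (fun c => c.2 < f c.1) ↔ j < f i := by
    intro i j
    simp only [Finset.mem_filter, Finset.mem_product, Finset.mem_range, and_iff_right_iff_imp]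
    intro h
    refine ⟨?_, h.trans_le (hanti (Nat.zero_le i))⟩
    by_contra hi
    have := hanti (not_lt.mp hi)
    omega
  refine ⟨⟨(Finset.range N ×ˢ Finset.range (f 0)).filter (fun c => c.2 < f c.1), ?_⟩, fun i => ?_⟩
  · rintro ⟨i, j⟩ ⟨i', j'⟩ hle hij
    have h1 := (hmem i j).mp hij
    exact (hmem i' j').mpr ((hle.2.trans_lt h1).trans_le (hanti hle.1))
  · refine eq_of_forall_lt_iff fun j => ?_
    rw [← YoungDiagram.mem_iff_lt_rowLen]
    exact hmem i j

/-! ### Row factorization of the branching and Pieri weights -/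

section Weights

variable {K : Type*} [Field K] {A : Type*} [CommRing A] [Algebra K A]

open Classical in
/-- The coefficient of `F_lam` in the product of `F_nu` with `∏ (1 - x_i)`. -/
noncomputable def pieriWeight (q : K) (lam nu : YoungDiagram) : K :=
  if IsHorizontalStrip lam nu ∧ IsVerticalStrip lam nu then
    (-1) ^ (lam.card - nu.card) * eta q lam nu * (1 - q) ^ (lam.card - nu.card)
  else 0

/-- Rows beyond the length contribute $1$, so a common cutoff $N$ can serve all the diagrams, and
the global power of $x$ splits into row contributions. -/
theorem skewOne_eq_prod (q : K) (x : A) {lam mu : YoungDiagram} (h : IsHorizontalStrip lam mu)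
    {N : ℕ} (hN : lam.colLen 0 ≤ N) :
    skewOne q lam mu x = ∏ j ∈ Finset.range N,
      powWeight q x ((lam.rowLen j : ℤ) - mu.rowLen j) *
        pochWeight q x ((mu.rowLen j : ℤ) - lam.rowLen (j + 1)) *
          algebraMap K A (qPoch q q (lam.rowLen j - lam.rowLen (j + 1))) := by
  have hi := isHorizontalStrip_iff.mp h
  have hmu : mu.colLen 0 ≤ N :=
    colLen_zero_le_of_rowLen_eq_zero mu (Nat.eq_zero_of_le_zero
      ((hi N).1.trans (rowLen_eq_zero_of_colLen_le lam hN).le))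
  rw [skewOne, if_pos h, card_eq_sum_rowLen lam hN, card_eq_sum_rowLen mu hmu,
    ← Finset.sum_tsub_distrib _ fun j _ => (hi j).1, ← Finset.prod_pow_eq_pow_sum]
  rw [Finset.prod_subset (Finset.range_mono hN) fun j _ hj => ?_, ← Finset.prod_mul_distrib]
  · refine Finset.prod_congr rfl fun j _ => ?_
    rw [← Nat.cast_sub (hi j).1, ← Nat.cast_sub (hi j).2, powWeight_natCast, pochWeight_natCast,
      div_eq_mul_inv, mul_inv]
    simp only [map_mul]
    ring
  · have hj' : lam.colLen 0 ≤ j := by simpa using hj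
    have h0 := rowLen_eq_zero_of_colLen_le lam hj'
    have h1 := rowLen_eq_zero_of_colLen_le lam (hj'.trans (Nat.le_succ j))
    have h2 : mu.rowLen j = 0 := Nat.eq_zero_of_le_zero ((hi j).1.trans h0.le)
    simp [h0, h1, h2, qPoch]

/-- Each row grows by $0$ or $1$, so $(q;q)_{\lambda_j-\nu_j}$ is $1$ or $1-q$ and cancels the power
of $1-q$, leaving one sign per added box. -/
theorem pieriWeight_eq_prod (q : K) (hq : ∀ k : ℕ, 0 < k → q ^ k ≠ 1) {lam nu : YoungDiagram}
    (h : IsHorizontalStrip lam nu) (hv : IsVerticalStrip lam nu) {N : ℕ}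
    (hN : lam.colLen 0 ≤ N) :
    pieriWeight q lam nu = ∏ j ∈ Finset.range N,
      (if nu.rowLen j < lam.rowLen j then -1 else 1) *
        (qPoch q q (nu.rowLen j - nu.rowLen (j + 1)) /
          qPoch q q (nu.rowLen j - lam.rowLen (j + 1))) := by
  have hi := isHorizontalStrip_iff.mp h
  have hnu : nu.colLen 0 ≤ N :=
    colLen_zero_le_of_rowLen_eq_zero nu (Nat.eq_zero_of_le_zero
      ((hi N).1.trans (rowLen_eq_zero_of_colLen_le lam hN).le))
  rw [pieriWeight, if_pos ⟨h, hv⟩, mul_right_comm, ← mul_pow, card_eq_sum_rowLen lam hN,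
    card_eq_sum_rowLen nu hnu, ← Finset.sum_tsub_distrib _ fun j _ => (hi j).1,
    ← Finset.prod_pow_eq_pow_sum, eta]
  rw [Finset.prod_subset (Finset.range_mono hN) fun j _ hj => ?_, ← Finset.prod_mul_distrib]
  · refine Finset.prod_congr rfl fun j _ => ?_
    have hvj := hv.2 j
    have hj := (hi j).1
    split_ifs with hlt
    · have h1 : lam.rowLen j - nu.rowLen j = 1 := by omega
      have hq1 : (1 : K) - q ≠ 0 := sub_ne_zero.mpr fun h => hq 1 one_pos (by rw [pow_one, ← h])
      have hne := qPoch_ne_zero q hq (nu.rowLen j - lam.rowLen (j + 1))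
      rw [h1]
      simp only [qPoch, Finset.prod_range_one, pow_zero, mul_one, pow_one] at hne ⊢
      field_simp
    · have h1 : lam.rowLen j - nu.rowLen j = 0 := by omega
      rw [h1]
      simp [qPoch]
  · have hj' : lam.colLen 0 ≤ j := by simpa using hj
    have h0 := rowLen_eq_zero_of_colLen_le lam hj'
    have h1 := rowLen_eq_zero_of_colLen_le lam (hj'.trans (Nat.le_succ j))
    have h2 : nu.rowLen j = 0 := Nat.eq_zero_of_le_zero ((hi j).1.trans h0.le)
    simp [h0, h1, h2, qPoch]

/-- The first `N` rows in which `lam` is longer than `nu`. -/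
def longerRows (N : ℕ) (lam nu : YoungDiagram) : Finset ℕ :=
  (Finset.range N).filter fun j => nu.rowLen j < lam.rowLen j

theorem rowLen_eq_add_bit {lam nu : YoungDiagram} (hv : IsVerticalStrip lam nu) {N : ℕ}
    (hN : lam.colLen 0 ≤ N) (j : ℕ) :
    lam.rowLen j = nu.rowLen j + bit (longerRows N lam nu) j := by
  have h1 := hv.2 j
  have h2 := le_iff_rowLen_le.mp hv.1 j
  have h3 : N ≤ j → lam.rowLen j = 0 := fun h => rowLen_eq_zero_of_colLen_le lam (hN.trans h)
  simp only [bit, longerRows, Finset.mem_filter, Finset.mem_range]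
  split_ifs <;> omega

theorem bit_of_mem {T : Finset ℕ} {j : ℕ} (h : j ∈ T) : bit T j = 1 := if_pos h

theorem bit_of_notMem {T : Finset ℕ} {j : ℕ} (h : j ∉ T) : bit T j = 0 := if_neg h

theorem qPoch_succ_div (q : K) (hq : ∀ k : ℕ, 0 < k → q ^ k ≠ 1) (k : ℕ) :
    qPoch q q (k + 1) / qPoch q q k = 1 - q ^ (k + 1) := by
  rw [qPoch_succ, mul_div_cancel_left₀ _ (qPoch_ne_zero q hq k), pow_succ']

/-- The denominator $(q;q)_{\nu_j-\lambda_{j+1}}$ of the Pieri weight meets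
$(q;q)_{\lambda_j-\lambda_{j+1}}$ of the branching weight. Their quotient is $1$, or the single
factor $1-q^{\nu_j-\lambda_{j+1}+1}$ when row $j$ gains a box. -/
theorem pieriWeight_mul_skewOne (q : K) (hq : ∀ k : ℕ, 0 < k → q ^ k ≠ 1) (x : A)
    {lam nu rho : YoungDiagram} (h : IsHorizontalStrip lam nu) (hv : IsVerticalStrip lam nu)
    (hrho : IsHorizontalStrip lam rho) {N : ℕ} (hN : lam.colLen 0 ≤ N) :
    algebraMap K A (pieriWeight q lam nu) * skewOne q lam rho x =
      (∏ j ∈ Finset.range N, algebraMap K A (qPoch q q (nu.rowLen j - nu.rowLen (j + 1)))) *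
        ∏ j ∈ Finset.range N, addFactor q x (fun j => (nu.rowLen j : ℤ) - rho.rowLen j)
          (fun j => (rho.rowLen j : ℤ) - nu.rowLen (j + 1)) (longerRows N lam nu) j := by
  rw [pieriWeight_eq_prod q hq h hv hN, skewOne_eq_prod q x hrho hN, map_prod,
    ← Finset.prod_mul_distrib, ← Finset.prod_mul_distrib]
  refine Finset.prod_congr rfl fun j hj => ?_
  have e0 := rowLen_eq_add_bit hv hN j
  have e1 := rowLen_eq_add_bit hv hN (j + 1)
  have hi := isHorizontalStrip_iff.mp h j
  have hp : ((rho.rowLen j : ℤ) - nu.rowLen (j + 1) - bit (longerRows N lam nu) (j + 1)) =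
      (rho.rowLen j : ℤ) - lam.rowLen (j + 1) := by rw [e1]; push_cast; ring
  simp only [addFactor, hp]
  by_cases hT : j ∈ longerRows N lam nu
  · rw [bit_of_mem hT] at e0
    rw [if_pos hT, if_pos (by omega)]
    have hs : (nu.rowLen j : ℤ) - rho.rowLen j + 1 = (lam.rowLen j : ℤ) - rho.rowLen j := by
      rw [e0]; push_cast; ring
    have hk : (rho.rowLen j : ℤ) - nu.rowLen (j + 1) + (nu.rowLen j - rho.rowLen j) + 1 -
        bit (longerRows N lam nu) (j + 1) = ((nu.rowLen j - lam.rowLen (j + 1) + 1 : ℕ) : ℤ) := by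
      push_cast [hi.2]
      rw [e1]; push_cast; ring
    have hl : lam.rowLen j - lam.rowLen (j + 1) = nu.rowLen j - lam.rowLen (j + 1) + 1 := by omega
    have key : algebraMap K A (qPoch q q (nu.rowLen j - nu.rowLen (j + 1)) /
        qPoch q q (nu.rowLen j - lam.rowLen (j + 1))) *
          algebraMap K A (qPoch q q (nu.rowLen j - lam.rowLen (j + 1) + 1)) =
        algebraMap K A (qPoch q q (nu.rowLen j - nu.rowLen (j + 1))) *
          (1 - algebraMap K A q ^ (nu.rowLen j - lam.rowLen (j + 1) + 1)) := by
      rw [← map_mul, div_mul_eq_mul_div, mul_div_assoc, qPoch_succ_div q hq]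
      simp
    rw [hs, hk, hl, qPow_natCast, neg_one_mul, map_neg]
    linear_combination -(powWeight q x ((lam.rowLen j : ℤ) - rho.rowLen j) *
      pochWeight q x ((rho.rowLen j : ℤ) - lam.rowLen (j + 1))) * key
  · rw [bit_of_notMem hT, add_zero] at e0
    rw [if_neg hT, if_neg (by omega), ← e0, one_mul]
    have key : algebraMap K A (qPoch q q (lam.rowLen j - nu.rowLen (j + 1)) /
        qPoch q q (lam.rowLen j - lam.rowLen (j + 1))) *
          algebraMap K A (qPoch q q (lam.rowLen j - lam.rowLen (j + 1))) =
        algebraMap K A (qPoch q q (lam.rowLen j - nu.rowLen (j + 1))) := by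
      rw [← map_mul, div_mul_cancel₀ _ (qPoch_ne_zero q hq _)]
    linear_combination (powWeight q x ((lam.rowLen j : ℤ) - rho.rowLen j) *
      pochWeight q x ((rho.rowLen j : ℤ) - lam.rowLen (j + 1))) * key

/-- Here the prefactor comes directly from $\mathbb F_{\nu/\kappa}$. The remaining quotient in the
Pieri weight depends on whether row $j+1$ loses a box, so it is charged to that row. -/
theorem skewOne_mul_pieriWeight (q : K) (hq : ∀ k : ℕ, 0 < k → q ^ k ≠ 1) (x : A)
    {nu kap rho : YoungDiagram} (h : IsHorizontalStrip rho kap) (hv : IsVerticalStrip rho kap)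
    (hnu : IsHorizontalStrip nu kap) {N : ℕ} (hN : nu.colLen 0 ≤ N) (hN' : rho.colLen 0 ≤ N) :
    skewOne q nu kap x * algebraMap K A (pieriWeight q rho kap) =
      (∏ j ∈ Finset.range N, algebraMap K A (qPoch q q (nu.rowLen j - nu.rowLen (j + 1)))) *
        ∏ j ∈ Finset.range N, removeFactor q x (fun j => (nu.rowLen j : ℤ) - rho.rowLen j)
          (fun j => (rho.rowLen j : ℤ) - nu.rowLen (j + 1)) (longerRows N rho kap) j := by
  set T := longerRows N rho kap with hTdef
  set s : ℕ → ℤ := fun j => (nu.rowLen j : ℤ) - rho.rowLen j with hs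
  set p : ℕ → ℤ := fun j => (rho.rowLen j : ℤ) - nu.rowLen (j + 1) with hp
  have e := rowLen_eq_add_bit hv hN'
  rw [← hTdef] at e
  have hi := isHorizontalStrip_iff.mp h
  have hinu := isHorizontalStrip_iff.mp hnu
  -- `u (j + 1)` is the Pieri quotient attached to row $j$: the exponent $\kappa_j-\kappa_{j+1}$
  -- splits at $\nu_{j+1}$ into the link and $s_{j+1}+1$. The shift of index costs nothing because
  -- `u 0 = u N = 1`.
  let u : ℕ → A := fun j => if j ∈ T then 1 - link A q p T j * qPow A q (s j + 1) else 1
  have hu : ∏ j ∈ Finset.range N, algebraMap K A (qPoch q q (kap.rowLen j - kap.rowLen (j + 1)) /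
      qPoch q q (kap.rowLen j - rho.rowLen (j + 1))) = ∏ j ∈ Finset.range N, u j := by
    have h0 : u 0 = 1 := by simp [u, link]
    have hN0 : u N = 1 := if_neg (by simp [hTdef, longerRows])
    have hsucc : ∀ j, u (j + 1) =
        algebraMap K A (qPoch q q (kap.rowLen j - kap.rowLen (j + 1)) /
          qPoch q q (kap.rowLen j - rho.rowLen (j + 1))) := by
      intro j
      have ej := e j
      have ej1 := e (j + 1)
      by_cases hT : j + 1 ∈ T
      · rw [bit_of_mem hT] at ej1
        have h1 : p j - bit T j = ((kap.rowLen j - nu.rowLen (j + 1) : ℕ) : ℤ) := by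
          have := (hinu j).2
          simp only [hp]
          omega
        have h2 : s (j + 1) + 1 = ((nu.rowLen (j + 1) - kap.rowLen (j + 1) : ℕ) : ℤ) := by
          have := (hinu (j + 1)).1
          simp only [hs]
          omega
        have h3 : kap.rowLen j - kap.rowLen (j + 1) =
            kap.rowLen j - rho.rowLen (j + 1) + 1 := by
          have := (hi j).2
          omega
        have h4 : kap.rowLen j - nu.rowLen (j + 1) + (nu.rowLen (j + 1) - kap.rowLen (j + 1)) =
            kap.rowLen j - rho.rowLen (j + 1) + 1 := by
          have := (hi j).2
          have := (hinu j).2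
          have := (hinu (j + 1)).1
          omega
        simp only [u, if_pos hT, link, h1, h2, qPow_natCast, ← pow_add, h4]
        rw [h3, qPoch_succ_div q hq]
        simp
      · rw [bit_of_notMem hT, add_zero] at ej1
        simp only [u, if_neg hT]
        rw [ej1, div_self (qPoch_ne_zero q hq _), map_one]
    have := (Finset.prod_range_succ u N).symm.trans (Finset.prod_range_succ' u N)
    rw [h0, hN0, mul_one, mul_one] at this
    rw [this]
    exact Finset.prod_congr rfl fun j _ => (hsucc j).symm
  rw [pieriWeight_eq_prod q hq h hv hN', skewOne_eq_prod q x hnu hN, Finset.prod_mul_distrib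
    (f := fun j => if kap.rowLen j < rho.rowLen j then (-1 : K) else 1), map_mul, map_prod,
    map_prod, hu, ← Finset.prod_mul_distrib, ← Finset.prod_mul_distrib,
    ← Finset.prod_mul_distrib]
  refine Finset.prod_congr rfl fun j hj => ?_
  have ej := e j
  simp only [u, removeFactor]
  by_cases hT : j ∈ T
  · rw [bit_of_mem hT] at ej
    have h1 : s j + 1 = (nu.rowLen j : ℤ) - kap.rowLen j := by simp only [hs]; omega
    have h2 : p j - 1 = (kap.rowLen j : ℤ) - nu.rowLen (j + 1) := by simp only [hp]; omega
    rw [if_pos hT, if_pos hT, if_pos (by omega), h1, h2, map_neg, map_one]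
    ring
  · rw [bit_of_notMem hT] at ej
    have h1 : s j = (nu.rowLen j : ℤ) - kap.rowLen j := by simp only [hs]; omega
    have h2 : p j = (kap.rowLen j : ℤ) - nu.rowLen (j + 1) := by simp only [hp]; omega
    rw [if_neg hT, if_neg hT, if_neg (by omega), h1, h2, map_one]
    ring

end Weights

/-! ### The one-variable commutation relation -/

section Commutation

variable {K : Type*} [Field K] {A : Type*} [CommRing A] [Algebra K A]

theorem isHorizontalStrip_refl (nu : YoungDiagram) : IsHorizontalStrip nu nu :=
  ⟨le_rfl, fun j => by simp⟩

theorem isVerticalStrip_refl (nu : YoungDiagram) : IsVerticalStrip nu nu :=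
  ⟨le_rfl, fun j => by simp⟩

open Classical in
theorem mem_insert_pieriSet {lam nu : YoungDiagram} :
    lam ∈ insert nu (pieriSet nu) ↔ IsHorizontalStrip lam nu ∧ IsVerticalStrip lam nu := by
  rw [Finset.mem_insert, mem_pieriSet]
  constructor
  · rintro (rfl | h)
    · exact ⟨isHorizontalStrip_refl lam, isVerticalStrip_refl lam⟩
    · exact h.2
  · intro h
    by_cases hl : lam = nu
    · exact Or.inl hl
    · exact Or.inr ⟨hl, h⟩

theorem longerRows_injective {N : ℕ} {lam lam' nu : YoungDiagram} (hv : IsVerticalStrip lam nu)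
    (hv' : IsVerticalStrip lam' nu) (hN : lam.colLen 0 ≤ N) (hN' : lam'.colLen 0 ≤ N)
    (h : longerRows N lam nu = longerRows N lam' nu) : lam = lam' :=
  eq_of_rowLen_eq fun j => by
    rw [rowLen_eq_add_bit hv hN, rowLen_eq_add_bit hv' hN', h]

theorem longerRows_injective_right {N : ℕ} {lam nu nu' : YoungDiagram}
    (hv : IsVerticalStrip lam nu) (hv' : IsVerticalStrip lam nu') (hN : lam.colLen 0 ≤ N)
    (h : longerRows N lam nu = longerRows N lam nu') : nu = nu' :=
  eq_of_rowLen_eq fun j => by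
    have h1 := rowLen_eq_add_bit hv hN j
    have h2 := rowLen_eq_add_bit hv' hN j
    rw [h] at h1
    omega

theorem longerRows_eq {N : ℕ} {lam nu : YoungDiagram} {T : Finset ℕ} (hT : T ⊆ Finset.range N)
    (h : ∀ j, lam.rowLen j = nu.rowLen j + bit T j) : longerRows N lam nu = T := by
  ext j
  have := h j
  simp only [longerRows, Finset.mem_filter, bit] at this ⊢
  constructor
  · rintro ⟨-, hlt⟩
    by_contra hj
    rw [if_neg hj] at this
    omega
  · intro hj
    rw [if_pos hj] at this
    exact ⟨hT hj, by omega⟩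

theorem colLen_le_succ {lam nu : YoungDiagram} (h : IsHorizontalStrip lam nu) :
    lam.colLen 0 ≤ nu.colLen 0 + 1 := by
  refine colLen_zero_le_of_rowLen_eq_zero lam (Nat.eq_zero_of_le_zero ?_)
  exact ((isHorizontalStrip_iff.mp h _).2).trans (rowLen_eq_zero_of_colLen_le nu le_rfl).le

theorem nonneg_of_powWeight_ne_zero {q : K} {x : A} {s : ℤ} (h : powWeight q x s ≠ 0) : 0 ≤ s :=
  not_lt.mp fun hs => h (powWeight_of_neg q x hs)

theorem nonneg_of_pochWeight_ne_zero {q : K} {x : A} {p : ℤ} (h : pochWeight q x p ≠ 0) :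
    0 ≤ p :=
  not_lt.mp fun hp => h (pochWeight_of_neg q x hp)

/-- A set of rows with nonzero weight comes from a diagram obtained by adding boxes. -/
theorem exists_of_prod_addFactor_ne_zero (q : K) (x : A) {nu rho : YoungDiagram} {N : ℕ}
    {T : Finset ℕ} (hT : T ⊆ Finset.range N) (hN : nu.colLen 0 ≤ N) (hN' : rho.colLen 0 < N)
    (hne : ∏ j ∈ Finset.range N, addFactor q x (fun j => (nu.rowLen j : ℤ) - rho.rowLen j)
      (fun j => (rho.rowLen j : ℤ) - nu.rowLen (j + 1)) T j ≠ 0) :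
    ∃ lam, IsHorizontalStrip lam nu ∧ IsVerticalStrip lam nu ∧ IsHorizontalStrip lam rho ∧
      longerRows N lam nu = T := by
  have hbit : ∀ j, bit T j ≤ 1 := fun j => by unfold bit; split_ifs <;> omega
  have hout : ∀ j, N ≤ j → bit T j = 0 := fun j hj =>
    bit_of_notMem fun h => by have := Finset.mem_range.mp (hT h); omega
  have hnu : ∀ j, N ≤ j → nu.rowLen j = 0 := fun j hj =>
    rowLen_eq_zero_of_colLen_le nu (hN.trans hj)
  have hrho : ∀ j, N ≤ j → rho.rowLen j = 0 := fun j hj =>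
    rowLen_eq_zero_of_colLen_le rho (hN'.le.trans hj)
  have hfac : ∀ j, rho.rowLen j ≤ nu.rowLen j + bit T j ∧
      nu.rowLen (j + 1) + bit T (j + 1) ≤ rho.rowLen j ∧
        nu.rowLen (j + 1) + bit T (j + 1) ≤ nu.rowLen j := by
    intro j
    have hanti := nu.rowLen_anti j (j + 1) (Nat.le_succ j)
    rcases lt_or_ge j N with hj | hj
    · have h0 : addFactor q x _ _ T j ≠ 0 := fun h =>
        hne (Finset.prod_eq_zero (Finset.mem_range.mpr hj) h)
      rw [addFactor] at h0
      have h1 := nonneg_of_pochWeight_ne_zero (right_ne_zero_of_mul h0)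
      have h2 := left_ne_zero_of_mul h0
      have hb := hbit (j + 1)
      by_cases hjT : j ∈ T
      · rw [if_pos hjT, neg_ne_zero] at h2
        have h3 := nonneg_of_powWeight_ne_zero (left_ne_zero_of_mul h2)
        rw [bit_of_mem hjT]
        refine ⟨by omega, by omega, ?_⟩
        -- The strip condition fails here only if $\nu_j=\nu_{j+1}$ and both rows gain a box; then
        -- the exponent is $0$ and the factor $1-q^0$ kills the product.
        by_contra hlt
        refine right_ne_zero_of_mul h2 ?_
        rw [show (rho.rowLen j : ℤ) - nu.rowLen (j + 1) + (nu.rowLen j - rho.rowLen j) + 1 -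
          bit T (j + 1) = ((0 : ℕ) : ℤ) by push_cast; omega, qPow_natCast, pow_zero, sub_self]
      · rw [if_neg hjT] at h2
        have h3 := nonneg_of_powWeight_ne_zero h2
        rw [bit_of_notMem hjT]
        refine ⟨by omega, by omega, by omega⟩
    · have := hnu (j + 1) (by omega)
      have := hout (j + 1) (by omega)
      have := hrho j hj
      omega
  obtain ⟨lam, hlam⟩ := exists_rowLen_eq (fun j => nu.rowLen j + bit T j)
    (fun j => (hfac j).2.2.trans (Nat.le_add_right _ _)) N
    (by simp [hnu N le_rfl, hout N le_rfl])
  refine ⟨lam, isHorizontalStrip_iff.mpr fun j => ?_, ⟨le_iff_rowLen_le.mpr fun j => ?_,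
    fun j => ?_⟩, isHorizontalStrip_iff.mpr fun j => ?_, longerRows_eq hT hlam⟩
  · rw [hlam, hlam]
    exact ⟨Nat.le_add_right _ _, (hfac j).2.2⟩
  · rw [hlam]
    exact Nat.le_add_right _ _
  · rw [hlam]
    have := hbit j
    omega
  · rw [hlam, hlam]
    exact ⟨(hfac j).1, (hfac j).2.1⟩

/-- A set of rows with nonzero weight comes from a diagram obtained by removing boxes. -/
theorem exists_of_prod_removeFactor_ne_zero (q : K) (x : A) {nu rho : YoungDiagram} {N : ℕ}
    {T : Finset ℕ} (hT : T ⊆ Finset.range N) (hN : nu.colLen 0 ≤ N) (hN' : rho.colLen 0 ≤ N)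
    (hne : ∏ j ∈ Finset.range N, removeFactor q x (fun j => (nu.rowLen j : ℤ) - rho.rowLen j)
      (fun j => (rho.rowLen j : ℤ) - nu.rowLen (j + 1)) T j ≠ 0) :
    ∃ kap, IsHorizontalStrip rho kap ∧ IsVerticalStrip rho kap ∧ IsHorizontalStrip nu kap ∧
      longerRows N rho kap = T := by
  have hbit : ∀ j, bit T j ≤ 1 := fun j => by unfold bit; split_ifs <;> omega
  have hout : ∀ j, N ≤ j → bit T j = 0 := fun j hj =>
    bit_of_notMem fun h => by have := Finset.mem_range.mp (hT h); omega
  have hnu : ∀ j, N ≤ j → nu.rowLen j = 0 := fun j hj =>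
    rowLen_eq_zero_of_colLen_le nu (hN.trans hj)
  have hrho : ∀ j, N ≤ j → rho.rowLen j = 0 := fun j hj =>
    rowLen_eq_zero_of_colLen_le rho (hN'.trans hj)
  have hfac : ∀ j, nu.rowLen (j + 1) + bit T j ≤ rho.rowLen j ∧
      rho.rowLen j ≤ nu.rowLen j + bit T j := by
    intro j
    rcases lt_or_ge j N with hj | hj
    · have h0 : removeFactor q x _ _ T j ≠ 0 := fun h =>
        hne (Finset.prod_eq_zero (Finset.mem_range.mpr hj) h)
      rw [removeFactor] at h0
      by_cases hjT : j ∈ T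
      · rw [if_pos hjT, neg_ne_zero] at h0
        have h1 := nonneg_of_pochWeight_ne_zero (right_ne_zero_of_mul h0)
        have h2 := nonneg_of_powWeight_ne_zero
          (right_ne_zero_of_mul (left_ne_zero_of_mul h0))
        rw [bit_of_mem hjT]
        omega
      · rw [if_neg hjT] at h0
        have h1 := nonneg_of_pochWeight_ne_zero (right_ne_zero_of_mul h0)
        have h2 := nonneg_of_powWeight_ne_zero (left_ne_zero_of_mul h0)
        rw [bit_of_notMem hjT]
        omega
    · have := hnu j hj
      have := hnu (j + 1) (by omega)
      have := hout j hj
      have := hrho j hj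
      omega
  have hstrip : ∀ j, rho.rowLen (j + 1) ≤ rho.rowLen j - bit T j := by
    intro j
    have h1 := hfac j
    have h2 := hfac (j + 1)
    have hb := hbit (j + 1)
    by_contra hlt
    -- The interlacing bounds leave one possible violation: $\rho_{j+1}=\nu_{j+1}+1$ and $\rho_j$
    -- minus its removed box equals $\nu_{j+1}$. Both exponents in row $j+1$ are then $0$, and its
    -- factor is $1-1$.
    have hjT : j + 1 ∈ T := by
      by_contra hjT
      rw [bit_of_notMem hjT] at h2
      omega
    rw [bit_of_mem hjT] at h2
    have hj : j + 1 < N := Finset.mem_range.mp (hT hjT)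
    refine hne (Finset.prod_eq_zero (Finset.mem_range.mpr hj) ?_)
    rw [removeFactor, if_pos hjT, link,
      show (rho.rowLen j : ℤ) - nu.rowLen (j + 1) - bit T j = ((0 : ℕ) : ℤ) by push_cast; omega,
      show (nu.rowLen (j + 1) : ℤ) - rho.rowLen (j + 1) + 1 = ((0 : ℕ) : ℤ) by push_cast; omega,
      qPow_natCast]
    simp
  obtain ⟨kap, hkap⟩ := exists_rowLen_eq (fun j => rho.rowLen j - bit T j)
    (fun j => (Nat.sub_le _ _).trans (hstrip j)) N (by simp [hrho N le_rfl])
  refine ⟨kap, isHorizontalStrip_iff.mpr fun j => ?_, ⟨le_iff_rowLen_le.mpr fun j => ?_,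
    fun j => ?_⟩, isHorizontalStrip_iff.mpr fun j => ?_, longerRows_eq hT fun j => ?_⟩
  · rw [hkap]
    exact ⟨Nat.sub_le _ _, hstrip j⟩
  · rw [hkap]
    exact Nat.sub_le _ _
  · rw [hkap]
    have := hbit j
    omega
  · rw [hkap]
    have := hfac j
    omega
  · rw [hkap]
    have := hfac j
    omega

open Classical in
/-- The Pieri operator commutes with the one-variable branching, up to the factor `1 - x`. -/
theorem pieriWeight_skewOne_comm (q : K) (hq : ∀ k : ℕ, 0 < k → q ^ k ≠ 1) (x : A)
    (nu rho : YoungDiagram) :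
    (1 - x) * ∑ kap ∈ between nu ⊥, skewOne q nu kap x * algebraMap K A (pieriWeight q rho kap) =
      ∑ lam ∈ insert nu (pieriSet nu), algebraMap K A (pieriWeight q lam nu) *
        skewOne q lam rho x := by
  -- The extra row leaves room for a box added below $\nu$ and makes $p$ vanish in the last row.
  set N := nu.colLen 0 + rho.colLen 0 + 1 with hNdef
  set s : ℕ → ℤ := fun j => (nu.rowLen j : ℤ) - rho.rowLen j with hs
  set p : ℕ → ℤ := fun j => (rho.rowLen j : ℤ) - nu.rowLen (j + 1) with hp
  set Q : A := ∏ j ∈ Finset.range N,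
    algebraMap K A (qPoch q q (nu.rowLen j - nu.rowLen (j + 1))) with hQ
  have hnuN : nu.colLen 0 ≤ N := by omega
  have hrhoN : rho.colLen 0 < N := by omega
  have hremove : ∑ kap ∈ between nu ⊥,
      skewOne q nu kap x * algebraMap K A (pieriWeight q rho kap) =
        ∑ T ∈ (Finset.range N).powerset, Q * ∏ j ∈ Finset.range N, removeFactor q x s p T j := by
    have hne : ∀ kap, skewOne q nu kap x * algebraMap K A (pieriWeight q rho kap) ≠ 0 →
        IsHorizontalStrip nu kap ∧ IsHorizontalStrip rho kap ∧ IsVerticalStrip rho kap := by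
      intro kap h
      refine ⟨?_, ?_⟩
      · by_contra hc
        exact h (by rw [skewOne, if_neg hc, zero_mul])
      · by_contra hc
        exact h (by rw [pieriWeight, if_neg hc, map_zero, mul_zero])
    -- Only nonzero terms are matched: nonvanishing on either side already encodes the strip
    -- conditions.
    refine Finset.sum_bij_ne_zero (fun kap _ _ => longerRows N rho kap) ?_ ?_ ?_ ?_
    · exact fun kap _ _ => Finset.mem_powerset.mpr (Finset.filter_subset _ _)
    · intro kap _ h kap' _ h' heq
      exact longerRows_injective_right (hne _ h).2.2 (hne _ h').2.2 hrhoN.le heq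
    · intro T hT h
      obtain ⟨kap, h1, h2, h3, rfl⟩ := exists_of_prod_removeFactor_ne_zero q x
        (Finset.mem_powerset.mp hT) hnuN hrhoN.le (right_ne_zero_of_mul h)
      refine ⟨kap, mem_between.mpr ⟨bot_le, h3⟩, ?_, rfl⟩
      rwa [skewOne_mul_pieriWeight q hq x h1 h2 h3 hnuN hrhoN.le]
    · intro kap _ h
      exact skewOne_mul_pieriWeight q hq x (hne _ h).2.1 (hne _ h).2.2 (hne _ h).1 hnuN hrhoN.le
  have hadd : ∑ lam ∈ insert nu (pieriSet nu), algebraMap K A (pieriWeight q lam nu) *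
      skewOne q lam rho x =
        ∑ T ∈ (Finset.range N).powerset, Q * ∏ j ∈ Finset.range N, addFactor q x s p T j := by
    have hne : ∀ lam, algebraMap K A (pieriWeight q lam nu) * skewOne q lam rho x ≠ 0 →
        IsHorizontalStrip lam rho := by
      intro lam h
      by_contra hc
      exact h (by rw [skewOne, if_neg hc, mul_zero])
    have hlen : ∀ lam, IsHorizontalStrip lam nu → lam.colLen 0 ≤ N := fun lam h => by
      have := colLen_le_succ h
      omega
    refine Finset.sum_bij_ne_zero (fun lam _ _ => longerRows N lam nu) ?_ ?_ ?_ ?_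
    · exact fun lam _ _ => Finset.mem_powerset.mpr (Finset.filter_subset _ _)
    · intro lam hl _ lam' hl' _ heq
      have h1 := mem_insert_pieriSet.mp hl
      have h2 := mem_insert_pieriSet.mp hl'
      exact longerRows_injective h1.2 h2.2 (hlen _ h1.1) (hlen _ h2.1) heq
    · intro T hT h
      obtain ⟨lam, h1, h2, h3, rfl⟩ := exists_of_prod_addFactor_ne_zero q x
        (Finset.mem_powerset.mp hT) hnuN hrhoN (right_ne_zero_of_mul h)
      refine ⟨lam, mem_insert_pieriSet.mpr ⟨h1, h2⟩, ?_, rfl⟩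
      rwa [pieriWeight_mul_skewOne q hq x h1 h2 h3 (hlen _ h1)]
    · intro lam hl h
      have h1 := mem_insert_pieriSet.mp hl
      exact pieriWeight_mul_skewOne q hq x h1.1 h1.2 (hne _ h) (hlen _ h1.1)
  have hpN : p (nu.colLen 0 + rho.colLen 0) = 0 := by
    simp only [hp]
    rw [rowLen_eq_zero_of_colLen_le rho (by omega), rowLen_eq_zero_of_colLen_le nu (by omega)]
    simp
  rw [hremove, hadd, ← Finset.mul_sum, ← Finset.mul_sum, hNdef,
    sum_prod_addFactor q hq x s p _ hpN]
  ring

end Commutation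

/-! ### The Pieri rule in finitely and infinitely many variables -/

section Pieri

variable {K : Type*} [Field K]

open MvPolynomial

theorem skewOne_bot_bot (q : K) {A : Type*} [CommRing A] [Algebra K A] (x : A) :
    skewOne q ⊥ ⊥ x = 1 := by
  have h : (⊥ : YoungDiagram).colLen 0 = 0 := by
    by_contra hne
    exact YoungDiagram.notMem_bot (0, 0)
      (YoungDiagram.mem_iff_lt_colLen.mpr (Nat.pos_of_ne_zero hne))
  rw [skewOne, if_pos (isHorizontalStrip_refl ⊥), h]
  simp

theorem polyF_bot (q : K) (n : ℕ) : polyF q n ⊥ = 1 := by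
  induction n with
  | zero => simp [polyF, skewF]
  | succ n ih =>
    have h : between ⊥ ⊥ = {⊥} := by
      ext kap
      rw [mem_between, Finset.mem_singleton]
      exact ⟨fun h => le_bot_iff.mp h.2.1, by rintro rfl; exact ⟨le_rfl, isHorizontalStrip_refl ⊥⟩⟩
    rw [polyF] at ih
    rw [polyF, skewF, h, Finset.sum_singleton, ih, skewOne_bot_bot, one_mul]

theorem pieriWeight_self (q : K) (hq : ∀ k : ℕ, 0 < k → q ^ k ≠ 1) (nu : YoungDiagram) :
    pieriWeight q nu nu = 1 := by
  rw [pieriWeight_eq_prod q hq (isHorizontalStrip_refl nu) (isVerticalStrip_refl nu) le_rfl]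
  refine Finset.prod_eq_one fun j _ => ?_
  rw [if_neg (lt_irrefl _), one_mul, div_self (qPoch_ne_zero q hq _)]

theorem pieriWeight_of_mem (q : K) {lam nu : YoungDiagram} (h : lam ∈ pieriSet nu) :
    pieriWeight q lam nu = -pieriCoeff q lam nu := by
  obtain ⟨hne, hh, hv⟩ := mem_pieriSet.mp h
  have hlt := card_lt_of_lt hh.1 (Ne.symm hne)
  obtain ⟨k, hk⟩ : ∃ k, lam.card - nu.card = k + 1 := ⟨lam.card - nu.card - 1, by omega⟩
  rw [pieriWeight, if_pos ⟨hh, hv⟩, pieriCoeff, hk, Nat.add_sub_cancel]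
  ring

-- Branching off the last variable brings in the factor $1-x_n$ and one application of the
-- commutation relation, which moves the Pieri weight past the branching weight.
open Classical in
theorem prod_one_sub_mul_polyF (q : K) (hq : ∀ k : ℕ, 0 < k → q ^ k ≠ 1) (n : ℕ)
    (nu : YoungDiagram) :
    (∏ i ∈ Finset.range n, (1 - X i)) * polyF q n nu =
      ∑ lam ∈ insert nu (pieriSet nu), C (pieriWeight q lam nu) * polyF q n lam := by
  induction n generalizing nu with
  | zero =>
    simp only [polyF, skewF, Finset.range_zero, Finset.prod_empty, mul_ite, mul_one,
      mul_zero, Finset.sum_ite_eq', mem_insert_pieriSet]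
    by_cases hnu : nu = ⊥
    · subst hnu
      rw [if_pos rfl, if_pos ⟨isHorizontalStrip_refl ⊥, isVerticalStrip_refl ⊥⟩,
        pieriWeight_self q hq, C_1]
    · rw [if_neg hnu, if_neg fun h => hnu (le_bot_iff.mp h.1.1)]
  | succ n ih =>
    have hbranch : ∀ lam, polyF q (n + 1) lam =
        ∑ kap ∈ between lam ⊥, polyF q n kap * skewOne q lam kap (X n) := fun lam => rfl
    -- A common finite range for the intermediate diagram $\rho$, padded by zero terms, allows the
    -- sums to be interchanged.
    let U := (between nu ⊥).biUnion (fun kap => insert kap (pieriSet kap)) ∪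
      (insert nu (pieriSet nu)).biUnion fun lam => between lam ⊥
    have hl : ∀ kap ∈ between nu ⊥,
        ∑ rho ∈ insert kap (pieriSet kap), C (pieriWeight q rho kap) * polyF q n rho =
          ∑ rho ∈ U, C (pieriWeight q rho kap) * polyF q n rho := by
      intro kap hk
      refine Finset.sum_subset (fun rho hrho => Finset.mem_union_left _
        (Finset.mem_biUnion.mpr ⟨kap, hk, hrho⟩)) fun rho _ hrho => ?_
      rw [mem_insert_pieriSet] at hrho
      rw [pieriWeight, if_neg hrho, C_0, zero_mul]
    have hr : ∀ lam ∈ insert nu (pieriSet nu),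
        ∑ rho ∈ between lam ⊥, polyF q n rho * skewOne q lam rho (X n : MvPolynomial ℕ K) =
          ∑ rho ∈ U, polyF q n rho * skewOne q lam rho (X n) := by
      intro lam hlam
      refine Finset.sum_subset (fun rho hrho => Finset.mem_union_right _
        (Finset.mem_biUnion.mpr ⟨lam, hlam, hrho⟩)) fun rho _ hrho => ?_
      rw [mem_between] at hrho
      rw [skewOne, if_neg fun h => hrho ⟨bot_le, h⟩, mul_zero]
    calc (∏ i ∈ Finset.range (n + 1), (1 - X i)) * polyF q (n + 1) nu
        = ∑ kap ∈ between nu ⊥, (1 - X n) * skewOne q nu kap (X n) *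
            ((∏ i ∈ Finset.range n, (1 - X i)) * polyF q n kap) := by
          rw [hbranch, Finset.prod_range_succ, Finset.mul_sum]
          exact Finset.sum_congr rfl fun kap _ => by ring
      _ = ∑ kap ∈ between nu ⊥, ∑ rho ∈ U, (1 - X n) * skewOne q nu kap (X n) *
            (C (pieriWeight q rho kap) * polyF q n rho) :=
          Finset.sum_congr rfl fun kap hk => by rw [ih, hl kap hk, Finset.mul_sum]
      _ = ∑ rho ∈ U, polyF q n rho * ((1 - X n) * ∑ kap ∈ between nu ⊥,
            skewOne q nu kap (X n) * algebraMap K _ (pieriWeight q rho kap)) := by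
          rw [Finset.sum_comm]
          refine Finset.sum_congr rfl fun rho _ => ?_
          rw [Finset.mul_sum, Finset.mul_sum]
          refine Finset.sum_congr rfl fun kap _ => ?_
          rw [algebraMap_eq]
          ring
      _ = ∑ rho ∈ U, ∑ lam ∈ insert nu (pieriSet nu), C (pieriWeight q lam nu) *
            (polyF q n rho * skewOne q lam rho (X n)) := by
          refine Finset.sum_congr rfl fun rho _ => ?_
          rw [pieriWeight_skewOne_comm q hq, Finset.mul_sum]
          refine Finset.sum_congr rfl fun lam _ => ?_
          rw [algebraMap_eq]
          ring
      _ = ∑ lam ∈ insert nu (pieriSet nu), C (pieriWeight q lam nu) * polyF q (n + 1) lam := by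
          rw [Finset.sum_comm]
          refine Finset.sum_congr rfl fun lam hlam => ?_
          rw [← Finset.mul_sum, hbranch, hr lam hlam]

theorem one_sub_prod_mul_polyF (q : K) (hq : ∀ k : ℕ, 0 < k → q ^ k ≠ 1) (n : ℕ)
    (nu : YoungDiagram) :
    (1 - ∏ i ∈ Finset.range n, (1 - X i)) * polyF q n nu =
      ∑ lam ∈ pieriSet nu, pieriCoeff q lam nu • polyF q n lam := by
  classical
  have hnot : nu ∉ pieriSet nu := fun h => (mem_pieriSet.mp h).1 rfl
  rw [sub_mul, one_mul, prod_one_sub_mul_polyF q hq, Finset.sum_insert hnot,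
    pieriWeight_self q hq, C_1, one_mul, sub_add_cancel_left, ← Finset.sum_neg_distrib]
  refine Finset.sum_congr rfl fun lam hlam => ?_
  rw [pieriWeight_of_mem q hlam, smul_eq_C_mul, C_neg, neg_mul, neg_neg]

theorem rowLen_box (i : ℕ) : box.rowLen i = if i = 0 then 1 else 0 := by
  refine eq_of_forall_lt_iff fun j => ?_
  rw [← YoungDiagram.mem_iff_lt_rowLen, ← YoungDiagram.mem_cells]
  simp only [box, Finset.mem_singleton, Prod.mk.injEq]
  split_ifs with h <;> omega

theorem rowLen_bot (i : ℕ) : (⊥ : YoungDiagram).rowLen i = 0 := by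
  by_contra h
  exact YoungDiagram.notMem_bot (i, 0)
    (YoungDiagram.mem_iff_lt_rowLen.mpr (Nat.pos_of_ne_zero h))

theorem pieriSet_bot : pieriSet ⊥ = {box} := by
  ext lam
  rw [mem_pieriSet, Finset.mem_singleton]
  constructor
  · rintro ⟨hne, hh, hv⟩
    have h1 : ∀ i, lam.rowLen (i + 1) = 0 := fun i =>
      Nat.eq_zero_of_le_zero (((isHorizontalStrip_iff.mp hh i).2).trans (rowLen_bot i).le)
    have h0 := hv.2 0
    rw [rowLen_bot, Nat.sub_zero] at h0
    have h2 : lam.rowLen 0 ≠ 0 := fun h => hne (eq_of_rowLen_eq fun i => by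
      cases i with
      | zero => rw [h, rowLen_bot]
      | succ i => rw [h1, rowLen_bot])
    refine eq_of_rowLen_eq fun i => ?_
    rw [rowLen_box]
    cases i with
    | zero => rw [if_pos rfl]; omega
    | succ i => rw [if_neg (Nat.succ_ne_zero i), h1]
  · rintro rfl
    refine ⟨fun h => ?_, isHorizontalStrip_iff.mpr fun i => ?_, bot_le, fun i => ?_⟩
    · have := congrArg (fun mu => YoungDiagram.rowLen mu 0) h
      simp [rowLen_box, rowLen_bot] at this
    · simp [rowLen_box, rowLen_bot]
    · rw [rowLen_box, rowLen_bot]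
      split_ifs <;> simp

theorem pieriCoeff_box (q : K) (hq : ∀ k : ℕ, 0 < k → q ^ k ≠ 1) : pieriCoeff q box ⊥ = 1 := by
  have hmem : box ∈ pieriSet ⊥ := by rw [pieriSet_bot]; exact Finset.mem_singleton_self _
  obtain ⟨-, hh, hv⟩ := mem_pieriSet.mp hmem
  have hlen : box.colLen 0 ≤ 1 :=
    colLen_zero_le_of_rowLen_eq_zero box (by simp [rowLen_box])
  rw [← neg_inj, ← pieriWeight_of_mem q hmem, pieriWeight_eq_prod q hq hh hv hlen]
  simp [rowLen_box, rowLen_bot, qPoch]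

/-- For $\nu=\varnothing$ the only term is the single box, with coefficient $1$, and $\mathbb
F_\varnothing=1$. -/
theorem polyF_box (q : K) (hq : ∀ k : ℕ, 0 < k → q ^ k ≠ 1) (n : ℕ) :
    polyF q n box = 1 - ∏ i ∈ Finset.range n, (1 - X i) := by
  have h := one_sub_prod_mul_polyF q hq n ⊥
  rw [pieriSet_bot, Finset.sum_singleton, pieriCoeff_box q hq, one_smul, polyF_bot,
    mul_one] at h
  exact h.symm

theorem polyF_box_mul_polyF (q : K) (hq : ∀ k : ℕ, 0 < k → q ^ k ≠ 1) (n : ℕ)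
    (nu : YoungDiagram) :
    polyF q n box * polyF q n nu = ∑ lam ∈ pieriSet nu, pieriCoeff q lam nu • polyF q n lam := by
  rw [polyF_box q hq, one_sub_prod_mul_polyF q hq]

/-- A coefficient at $m$ uses only monomials dividing $m$. All of these live in the variables up to
the last one of $m$, where the polynomial identity applies. -/
theorem powerF_box_mul_powerF (q : K) (hq : ∀ k : ℕ, 0 < k → q ^ k ≠ 1) (nu : YoungDiagram) :
    powerF q box * powerF q nu = ∑ lam ∈ pieriSet nu, pieriCoeff q lam nu • powerF q lam := by
  classical
  ext m
  have hlt : ∀ i ∈ m.support, i < m.support.sup Nat.succ := fun i hi =>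
    Finset.le_sup (f := Nat.succ) hi
  have hpoly := congrArg (coeff m) (polyF_box_mul_polyF q hq (m.support.sup Nat.succ) nu)
  rw [coeff_mul, coeff_sum] at hpoly
  rw [MvPowerSeries.coeff_mul, map_sum]
  convert hpoly using 1
  · refine Finset.sum_congr rfl fun d hd => ?_
    have hd' := Finset.HasAntidiagonal.mem_antidiagonal.mp hd
    have hle1 : d.1 ≤ m := hd' ▸ le_self_add
    have hle2 : d.2 ≤ m := hd' ▸ le_add_self
    rw [coeff_powerF q hq box d.1 _ fun i hi => hlt i (Finsupp.support_mono hle1 hi),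
      coeff_powerF q hq nu d.2 _ fun i hi => hlt i (Finsupp.support_mono hle2 hi)]
  · refine Finset.sum_congr rfl fun lam _ => ?_
    rw [MvPowerSeries.coeff_smul, coeff_powerF q hq lam m _ hlt, coeff_smul, smul_eq_mul]

end Pieri

end InhomWhittaker

theorem proposition3p3 {K : Type*} [Field K] (q : K) (hq : ∀ k : ℕ, 0 < k → q ^ k ≠ 1)
    (nu : YoungDiagram) :
    (∀ n : ℕ,
      InhomWhittaker.polyF q n InhomWhittaker.box * InhomWhittaker.polyF q n nu =
        ∑ lam ∈ InhomWhittaker.pieriSet nu,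
          InhomWhittaker.pieriCoeff q lam nu • InhomWhittaker.polyF q n lam) ∧
    InhomWhittaker.powerF q InhomWhittaker.box * InhomWhittaker.powerF q nu =
      ∑ lam ∈ InhomWhittaker.pieriSet nu,
        InhomWhittaker.pieriCoeff q lam nu • InhomWhittaker.powerF q lam :=
  ⟨fun n => InhomWhittaker.polyF_box_mul_polyF q hq n nu,
    InhomWhittaker.powerF_box_mul_powerF q hq nu⟩
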